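/- Fix a finite-dimensional Hilbert space $\mathcal H=\mathbb C^d$ with $d=\dim\mathcal H\ge 1$ and a finite, approximately universal set $\mathcal G$ of unitary gates (every unitary on $\mathcal H^{\otimes n}\otimes(\mathbb C^2)^{\otimes a}$ can be approximated arbitrarily well, up to a global phase and with the help of further ancilla qubits, by circuits over $\mathcal G$). An effect operator on $\mathcal H^{\otimes n}$ is an operator $E$ with $0\le E\le \mathbb 1$. It is implemented with $c$ gates if, for some number of ancilla qubits prepared in $|0\rangle$, some circuit $U$ consisting of $c$ gates from $\mathcal G$ acting on system and ancillas, some qubit $w$ and some $b\in\{0,1\}$, $E$ is the effect "measuring $w$ in the computational basis after applying $U$ gives $b$"; its gate complexity is the least such $c$. A polynomially generated set of effect operators is a family $\{\mathbf E_n^{\mathrm{eff}}\}_{n\in\mathbb N}$ of sets $\mathbf E_n^{\mathrm{eff}}$ of effect operators on $\mathcal H^{\otimes n}$ for which there is a polynomial $p$ such that (i) every $E\in\mathbf E_n^{\mathrm{eff}}$ has gate complexity at most $p(n)$; (ii) $E\in\mathbf E_n^{\mathrm{eff}}$ implies $\mathbb 1-E\in\mathbf E_n^{\mathrm{eff}}$;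 (iii) if $E_i\in\mathbf E_{n_i}^{\mathrm{eff}}$ has gate complexity $c_i$ $(i=1,2)$ and $c_1+c_2<p(n_1+n_2)$, then $E_1\otimes E_2\in\mathbf E_{n_1+n_2}^{\mathrm{eff}}$. Let $\overline{\mathbf E}_n^{\mathrm{eff}}=\mathrm{conv}(\mathbf E_n^{\mathrm{eff}})$. **Proposition.** Let $\{\mathbf E_n^{\mathrm{eff}}\}_{n\in\mathbb N}$ be a polynomially generated set of effect operators, $n\in\mathbb N$, $E\in\overline{\mathbf E}_n^{\mathrm{eff}}$ and $\varepsilon>0$. For every integer $$k\ \ge\ \frac{5\,(n\ln\dim\mathcal H+1)}{\varepsilon^2}$$ (in particular for $k=\lceil 5(n\ln\dim\mathcal H+1)/\varepsilon^2\rceil$) there are effect operators $E_{j_1},\dots,E_{j_k}\in\mathbf E_n^{\mathrm{eff}}$, not necessarily distinct, such that $$\Bigl\|E-\frac1k\sum_{i=1}^kE_{j_i}\Bigr\|_\infty\le\varepsilon ,$$ where $\|\cdot\|_\infty$ is the operator norm. -/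

import Mathlib

namespace EffMeas

/-- Computational basis labels of a register whose wire `i` carries the space `ℂ^(dim i)`. -/
abbrev Config {ι : Type} (dim : ι → ℕ) : Type := ∀ i, Fin (dim i)

/-- Operators on `H^{⊗n}` with `H = ℂ^d`, as matrices in the product basis. -/
abbrev Op (d n : ℕ) : Type := Matrix (Fin n → Fin d) (Fin n → Fin d) ℂ

/-- The operator norm (Schatten `∞`-norm) of a square complex matrix: its norm as a linear map
on Euclidean space. -/
noncomputable def opNorm {m : Type} [Fintype m] [DecidableEq m] (A : Matrix m m ℂ) : ℝ :=
  ‖Matrix.toEuclideanCLM (n := m) (𝕜 := ℂ) A‖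

/-- An elementary gate: a unitary acting on finitely many wires of prescribed dimensions. -/
structure Gate where
  arity : ℕ
  dim : Fin arity → ℕ
  mat : Matrix.unitaryGroup (Config dim) ℂ

/-- The gate `g` applied to the wires `f 0, f 1, …` of a register (of matching dimensions),
tensored with the identity on all the other wires. -/
noncomputable def Gate.place (g : Gate) {ι : Type} (dim : ι → ℕ)
    (f : Fin g.arity ↪ ι) (hf : ∀ i, dim (f i) = g.dim i) :
    Matrix (Config dim) (Config dim) ℂ :=
  open Classical in
  Matrix.of fun x y =>
    if ∀ j, j ∉ Set.range f → x j = y j then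
      (g.mat : Matrix (Config g.dim) (Config g.dim) ℂ)
        (fun i => Fin.cast (hf i) (x (f i))) (fun i => Fin.cast (hf i) (y (f i)))
    else 0

/-- `IsCircuit G dim c U`: the operator `U` on the register is the product of `c` gates,
each of them a member of `G` applied to some wires. -/
inductive IsCircuit (G : Set Gate) {ι : Type} [Fintype ι] [DecidableEq ι] (dim : ι → ℕ) :
    ℕ → Matrix (Config dim) (Config dim) ℂ → Prop
  | nil : IsCircuit G dim 0 1
  | cons {c : ℕ} {U : Matrix (Config dim) (Config dim) ℂ} (g : Gate) (hg : g ∈ G)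
      (f : Fin g.arity ↪ ι) (hf : ∀ i, dim (f i) = g.dim i) (hU : IsCircuit G dim c U) :
      IsCircuit G dim (c + 1) (g.place dim f hf * U)

/-- The register `H^{⊗n} ⊗ (ℂ²)^{⊗a}`: `n` system wires of dimension `d`, `a` ancilla qubits. -/
def regDim (d n a : ℕ) : Fin n ⊕ Fin a → ℕ := Sum.elim (fun _ => d) (fun _ => 2)

/-- The basis label of `|x⟩ ⊗ |0…0⟩`: system in `x`, all ancillas in `0`. -/
def initConfig (d n a : ℕ) (x : Fin n → Fin d) : Config (regDim d n a)
  | Sum.inl i => x i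
  | Sum.inr _ => (0 : Fin 2)

/-- The basis label of `|x⟩ ⊗ |0…0⟩` with `a'` further ancillas, all in `0`. -/
def extConfig (d n a a' : ℕ) (x : Config (regDim d n a)) : Config (regDim d n (a + a'))
  | Sum.inl i => x (Sum.inl i)
  | Sum.inr j => Fin.addCases (motive := fun _ => Fin 2)
      (fun k => x (Sum.inr k)) (fun _ => 0) j

/-- The projection `1 ⊗ |b⟩⟨b|` onto the outcome `b` of a computational basis measurement of
the wire `w`. -/
def outcomeProj {ι : Type} [Fintype ι] [DecidableEq ι] (dim : ι → ℕ) (w : ι) (b : Fin 2) :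
    Matrix (Config dim) (Config dim) ℂ :=
  Matrix.diagonal fun z => if (z w : ℕ) = (b : ℕ) then 1 else 0

/-- `ImplementableWith d G n c E`: the binary POVM `(E, 1 - E)` on `H^{⊗n}` is implemented with
`c` gates of `G`: append ancillas in the state `|0⟩`, apply a circuit `U` of `c` gates, measure a
single qubit `w` in the computational basis and discard everything else. Ancillas, measurement and
the naming of the two outcomes are free. Thus `E = V* (1 ⊗ |b⟩⟨b|) V`, where `V` is the
isometry `|x⟩ ↦ U (|x⟩ ⊗ |0…0⟩)`. -/
def ImplementableWith (d : ℕ) (G : Set Gate) (n c : ℕ) (E : Op d n) : Prop :=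
  ∃ (a : ℕ) (U : Matrix (Config (regDim d n a)) (Config (regDim d n a)) ℂ)
    (w : Fin n ⊕ Fin a) (b : Fin 2),
    IsCircuit G (regDim d n a) c U ∧ regDim d n a w = 2 ∧
      E = (U.submatrix id (initConfig d n a)).conjTranspose *
        outcomeProj (regDim d n a) w b * U.submatrix id (initConfig d n a)

/-- `c` is the gate complexity of the effect `E`: the minimal number of gates of `G` with which
it can be implemented. -/
def HasGateComplexity (d : ℕ) (G : Set Gate) (n : ℕ) (E : Op d n) (c : ℕ) : Prop :=
  IsLeast {c : ℕ | ImplementableWith d G n c E} c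

/-- Approximate universality: every unitary `V` on `n` system wires and `a` ancilla qubits is
approximated arbitrarily well, up to a global phase `u` and with the help of `a'` further ancillas
that start in `|0…0⟩` and are returned to it, by circuits over `G`.
(If the compression of the unitary `W` to the subspace where the further ancillas are `0` is close
to a unitary, then `W` nearly preserves that subspace.) -/
def IsApproxUniversal (d : ℕ) (G : Set Gate) : Prop :=
  ∀ (n a : ℕ) (V : Matrix.unitaryGroup (Config (regDim d n a)) ℂ) (δ : ℝ), 0 < δ →
    ∃ (a' c : ℕ) (W : Matrix (Config (regDim d n (a + a'))) (Config (regDim d n (a + a'))) ℂ)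
      (u : ℂ), IsCircuit G (regDim d n (a + a')) c W ∧ ‖u‖ = 1 ∧
        opNorm (W.submatrix (extConfig d n a a') (extConfig d n a a') -
          u • (V : Matrix (Config (regDim d n a)) (Config (regDim d n a)) ℂ)) ≤ δ

open scoped ComplexOrder in
/-- Effect operators: `0 ≤ E ≤ 1`. -/
def IsEffect {d n : ℕ} (E : Op d n) : Prop := E.PosSemidef ∧ (1 - E).PosSemidef

/-- `E₁ ⊗ E₂` as an operator on `H^{⊗(n₁+n₂)} = H^{⊗n₁} ⊗ H^{⊗n₂}`. -/
def tensorOp {d n₁ n₂ : ℕ} (E₁ : Op d n₁) (E₂ : Op d n₂) : Op d (n₁ + n₂) :=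
  Matrix.of fun x y =>
    E₁ (fun i => x (Fin.castAdd n₂ i)) (fun i => y (Fin.castAdd n₂ i)) *
      E₂ (fun i => x (Fin.natAdd n₁ i)) (fun i => y (Fin.natAdd n₁ i))

/-- Polynomially generated sets of effect operators over a finite approximately universal gate
set `G`, with polynomial `p`. -/
structure IsPolyGenerated (d : ℕ) (G : Set Gate) (p : Polynomial ℝ)
    (Eff : ∀ n : ℕ, Set (Op d n)) : Prop where
  gates_finite : G.Finite
  gates_universal : IsApproxUniversal d G
  isEffect : ∀ n, ∀ E ∈ Eff n, IsEffect E
  complexity_le : ∀ n, ∀ E ∈ Eff n,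
    ∃ c : ℕ, HasGateComplexity d G n E c ∧ (c : ℝ) ≤ p.eval (n : ℝ)
  compl_mem : ∀ n, ∀ E ∈ Eff n, 1 - E ∈ Eff n
  tensor_mem : ∀ n₁ n₂, ∀ E₁ ∈ Eff n₁, ∀ E₂ ∈ Eff n₂, ∀ c₁ c₂ : ℕ,
    HasGateComplexity d G n₁ E₁ c₁ → HasGateComplexity d G n₂ E₂ c₂ →
    (c₁ : ℝ) + (c₂ : ℝ) < p.eval ((n₁ + n₂ : ℕ) : ℝ) → tensorOp E₁ E₂ ∈ Eff (n₁ + n₂)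

end EffMeas

/-! This is a greedy, derandomized matrix Chernoff argument with potential `Tr cosh (t ∑ (Fᵢ - E))`.
Since `E` lies in the convex hull, some `F` in the set makes the linear term `Tr ((F - E) sinh M)`
nonpositive, where `M` is the current argument. Effects satisfy `-1 ≤ F - E ≤ 1`, so the
second-order bound `traceCosh_sub_le` lets each choice multiply the potential by at most `(1 + t²/2)
/ (1 - t²/2)`. The potential starts at the dimension `D` and dominates `cosh` of every eigenvalue of
its argument, so after `k` choices its logarithm bounds the norm of the sum. Taking `t = ε/2` gives
the claim. The trace inequality reduces to a scalar one: traces of products `f(A) g(B)` are sums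
over pairs of eigenvalues with common nonnegative weights `eigenOverlap`. -/

section ApproximateCaratheodory

open Matrix
open scoped ComplexOrder Matrix.Norms.L2Operator

variable {m : Type*} [Fintype m] [DecidableEq m]

/-! ### Traces in a pair of eigenbases -/

/-- Squared overlaps `|⟨uᵢ, vⱼ⟩|²` between the eigenbases of two Hermitian matrices. -/
noncomputable def eigenOverlap {A B : Matrix m m ℂ} (hA : A.IsHermitian) (hB : B.IsHermitian)
    (i j : m) : ℝ :=
  Complex.normSq ((star (hA.eigenvectorUnitary : Matrix m m ℂ) *
    (hB.eigenvectorUnitary : Matrix m m ℂ)) i j)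

theorem eigenOverlap_nonneg {A B : Matrix m m ℂ} (hA : A.IsHermitian) (hB : B.IsHermitian)
    (i j : m) : 0 ≤ eigenOverlap hA hB i j :=
  Complex.normSq_nonneg _

theorem cfc_eq_eigenvectorUnitary_mul {A : Matrix m m ℂ} (hA : A.IsHermitian) (f : ℝ → ℝ) :
    cfc f A = (hA.eigenvectorUnitary : Matrix m m ℂ) *
      diagonal (fun i => (f (hA.eigenvalues i) : ℂ)) *
        star (hA.eigenvectorUnitary : Matrix m m ℂ) := by
  rw [hA.cfc_eq]
  rfl

theorem re_trace_cfc_mul_cfc {A B : Matrix m m ℂ} (hA : A.IsHermitian) (hB : B.IsHermitian)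
    (f g : ℝ → ℝ) :
    (trace (cfc f A * cfc g B)).re =
      ∑ i, ∑ j, eigenOverlap hA hB i j * (f (hA.eigenvalues i) * g (hB.eigenvalues j)) := by
  rw [cfc_eq_eigenvectorUnitary_mul hA, cfc_eq_eigenvectorUnitary_mul hB]
  set U : Matrix m m ℂ := (hA.eigenvectorUnitary : Matrix m m ℂ)
  set V : Matrix m m ℂ := (hB.eigenvectorUnitary : Matrix m m ℂ)
  have h : trace (U * diagonal (fun i => (f (hA.eigenvalues i) : ℂ)) * star U *
      (V * diagonal (fun i => (g (hB.eigenvalues i) : ℂ)) * star V)) =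
      trace (diagonal (fun i => (f (hA.eigenvalues i) : ℂ)) * (star U * V) *
        diagonal (fun i => (g (hB.eigenvalues i) : ℂ)) * star (star U * V)) := by
    rw [star_mul, star_star]
    simp only [mul_assoc]
    rw [trace_mul_comm]
    simp only [mul_assoc]
  rw [h, trace, Complex.re_sum]
  refine Finset.sum_congr rfl fun i _ => ?_
  rw [diag_apply, mul_apply, Complex.re_sum]
  refine Finset.sum_congr rfl fun j _ => ?_
  rw [mul_diagonal, diagonal_mul, star_apply, eigenOverlap]
  have e : ∀ (a b : ℝ) (z : ℂ), ((a : ℂ) * z * b * star z).re = Complex.normSq z * (a * b) := by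
    intro a b z
    simp [Complex.normSq_apply]
    ring
  exact e _ _ _

/-! ### Scalar second-order bounds -/

theorem exp_sub_one_sub_le (x : ℝ) :
    Real.exp x - 1 - x ≤ x ^ 2 / 2 * (1 + Real.exp x) := by
  have hx := Real.exp_pos x
  rcases le_or_gt 1 (x ^ 2 / 2) with h | h
  -- Here `exp x ≤ x²/2 * exp x`, and `-1 - x ≤ x²/2` always.
  · nlinarith [mul_nonneg (sub_nonneg.2 h) hx.le, sq_nonneg (x + 1)]
  · have h2 : 0 ≤ 1 - x / 2 := by nlinarith
    have h3 : 1 - x / 2 ≤ Real.exp (-(x / 2)) := by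
      have := Real.add_one_le_exp (-(x / 2))
      linarith
    have h4 : (1 - x / 2) ^ 2 * Real.exp x ≤ 1 := by
      have h5 : (1 - x / 2) ^ 2 ≤ Real.exp (-(x / 2)) ^ 2 := by gcongr
      calc (1 - x / 2) ^ 2 * Real.exp x ≤ Real.exp (-(x / 2)) ^ 2 * Real.exp x := by gcongr
        _ = 1 := by
          rw [← Real.exp_nat_mul, ← Real.exp_add]
          norm_num
          ring
    have h6 : 0 ≤ 1 + x + x ^ 2 / 2 := by nlinarith [sq_nonneg (x + 1)]
    -- The difference of the two sides is `x²/8 * ((x - 1)² + 1)`. Multiplying by `exp x` and using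
    -- `h4` gives `(1 - x²/2) exp x ≤ 1 + x + x²/2`, the rearranged claim.
    have h7 : 1 - x ^ 2 / 2 ≤ (1 - x / 2) ^ 2 * (1 + x + x ^ 2 / 2) := by
      nlinarith [mul_nonneg (sq_nonneg x) (sq_nonneg (x - 1)), sq_nonneg x]
    nlinarith [mul_le_mul_of_nonneg_right h7 hx.le, mul_le_mul_of_nonneg_right h4 h6]

/-- Average of the exponential bound at `b - a` with weight `exp a` and at `a - b` with weight `exp
(-a)`. -/
theorem cosh_sub_cosh_sub_le (a b : ℝ) :
    Real.cosh b - Real.cosh a - (b - a) * Real.sinh a ≤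
      (b - a) ^ 2 / 2 * (Real.cosh a + Real.cosh b) := by
  have h1 := mul_le_mul_of_nonneg_left (exp_sub_one_sub_le (b - a)) (Real.exp_pos a).le
  have h2 := mul_le_mul_of_nonneg_left (exp_sub_one_sub_le (-b - -a)) (Real.exp_pos (-a)).le
  have e1 : Real.exp b = Real.exp a * Real.exp (b - a) := by rw [← Real.exp_add]; ring_nf
  have e2 : Real.exp (-b) = Real.exp (-a) * Real.exp (-b - -a) := by
    rw [← Real.exp_add]; ring_nf
  rw [Real.cosh_eq, Real.cosh_eq, Real.sinh_eq, e1, e2]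
  linarith

/-! ### The trace inequality for `cosh` -/

/-- The trace of the hyperbolic cosine of a Hermitian matrix. -/
noncomputable def traceCosh (A : Matrix m m ℂ) : ℝ := (trace (cfc Real.cosh A)).re

theorem cfc_one_of_isHermitian {A : Matrix m m ℂ} (hA : A.IsHermitian) :
    cfc (fun _ => (1 : ℝ)) A = 1 :=
  cfc_const_one ℝ A hA.isSelfAdjoint

theorem cfc_id_of_isHermitian {A : Matrix m m ℂ} (hA : A.IsHermitian) :
    cfc (fun x : ℝ => x) A = A :=
  cfc_id' ℝ A hA.isSelfAdjoint

theorem mul_cfc_of_isHermitian {A : Matrix m m ℂ} (hA : A.IsHermitian) {f : ℝ → ℝ}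
    (hf : Continuous f) : A * cfc f A = cfc (fun x => x * f x) A := by
  rw [cfc_mul (fun x => x) f A (by fun_prop) hf.continuousOn, cfc_id_of_isHermitian hA]

theorem cfc_mul_of_isHermitian {A : Matrix m m ℂ} (hA : A.IsHermitian) {f : ℝ → ℝ}
    (hf : Continuous f) : cfc f A * A = cfc (fun x => f x * x) A := by
  rw [cfc_mul f (fun x => x) A hf.continuousOn (by fun_prop), cfc_id_of_isHermitian hA]

theorem eigenOverlap_comm {A B : Matrix m m ℂ} (hA : A.IsHermitian) (hB : B.IsHermitian)
    (i j : m) : eigenOverlap hB hA j i = eigenOverlap hA hB i j := by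
  have h : star (hB.eigenvectorUnitary : Matrix m m ℂ) * (hA.eigenvectorUnitary : Matrix m m ℂ) =
      star (star (hA.eigenvectorUnitary : Matrix m m ℂ) *
        (hB.eigenvectorUnitary : Matrix m m ℂ)) := by
    rw [star_mul, star_star]
  rw [eigenOverlap, eigenOverlap, h, star_apply, ← starRingEnd_apply, Complex.normSq_conj]

theorem re_trace_cfc {A B : Matrix m m ℂ} (hA : A.IsHermitian) (hB : B.IsHermitian)
    (f : ℝ → ℝ) :
    (trace (cfc f A)).re = ∑ i, ∑ j, eigenOverlap hA hB i j * f (hA.eigenvalues i) := by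
  have h := re_trace_cfc_mul_cfc hA hB f (fun _ => 1)
  simpa only [cfc_one_of_isHermitian hB, mul_one] using h

theorem re_trace_sub_mul_cfc {A B : Matrix m m ℂ} (hA : A.IsHermitian) (hB : B.IsHermitian)
    {f : ℝ → ℝ} (hf : Continuous f) :
    (trace ((B - A) * cfc f A)).re = ∑ i, ∑ j, eigenOverlap hA hB i j *
      ((hB.eigenvalues j - hA.eigenvalues i) * f (hA.eigenvalues i)) := by
  have h1 := re_trace_cfc_mul_cfc hA hB f (fun x => x)
  have h2 := re_trace_cfc hA hB (fun x => x * f x)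
  rw [cfc_id_of_isHermitian hB] at h1
  rw [← mul_cfc_of_isHermitian hA hf] at h2
  rw [sub_mul, trace_sub, Complex.sub_re, trace_mul_comm, h1, h2]
  simp only [← Finset.sum_sub_distrib]
  refine Finset.sum_congr rfl fun i _ => Finset.sum_congr rfl fun j _ => ?_
  ring

/-- Although `A` and `B` need not commute, both cross terms have the same trace, by cyclicity and
because `A` commutes with `f(A)`. The expansion then matches the scalar square. -/
theorem re_trace_sub_sq_mul_cfc {A B : Matrix m m ℂ} (hA : A.IsHermitian) (hB : B.IsHermitian)
    {f : ℝ → ℝ} (hf : Continuous f) :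
    (trace ((B - A) ^ 2 * cfc f A)).re = ∑ i, ∑ j, eigenOverlap hA hB i j *
      ((hB.eigenvalues j - hA.eigenvalues i) ^ 2 * f (hA.eigenvalues i)) := by
  have hf1 : Continuous fun x => x * f x := by fun_prop
  have h0 := re_trace_cfc_mul_cfc hA hB f (fun x => x * x)
  have h1 := re_trace_cfc_mul_cfc hA hB (fun x => x * f x) (fun x => x)
  have h2 := re_trace_cfc hA hB (fun x => x * (x * f x))
  rw [← mul_cfc_of_isHermitian hB continuous_id', cfc_id_of_isHermitian hB] at h0
  rw [cfc_id_of_isHermitian hB] at h1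
  rw [← mul_cfc_of_isHermitian hA hf1] at h2
  have hc : cfc f A * A = A * cfc f A := by
    rw [mul_cfc_of_isHermitian hA hf, cfc_mul_of_isHermitian hA hf]
    simp only [mul_comm]
  have e : trace ((B - A) ^ 2 * cfc f A) = trace (cfc f A * (B * B)) -
      2 * trace (cfc (fun x => x * f x) A * B) + trace (A * cfc (fun x => x * f x) A) := by
    rw [← mul_cfc_of_isHermitian hA hf]
    have e1 : trace (A * B * cfc f A) = trace (A * cfc f A * B) := by
      rw [← hc, trace_mul_comm, ← mul_assoc]
    have e2 : trace (B * A * cfc f A) = trace (A * cfc f A * B) := by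
      rw [mul_assoc, trace_mul_comm]
    have e3 : trace (B * B * cfc f A) = trace (cfc f A * (B * B)) := trace_mul_comm _ _
    have e4 : (B - A) ^ 2 * cfc f A =
        B * B * cfc f A - A * B * cfc f A - B * A * cfc f A + A * (A * cfc f A) := by
      noncomm_ring
    rw [e4, trace_add, trace_sub, trace_sub, e1, e2, e3]
    ring
  have e' : (trace ((B - A) ^ 2 * cfc f A)).re = (trace (cfc f A * (B * B))).re -
      2 * (trace (cfc (fun x => x * f x) A * B)).re +
        (trace (A * cfc (fun x => x * f x) A)).re := by
    rw [e]
    simp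
  rw [e', h0, h1, h2]
  simp only [Finset.mul_sum, ← Finset.sum_sub_distrib, ← Finset.sum_add_distrib]
  refine Finset.sum_congr rfl fun i _ => Finset.sum_congr rfl fun j _ => ?_
  ring

/-- Second-order Klein-type trace inequality for the hyperbolic cosine. -/
theorem traceCosh_sub_le {A B : Matrix m m ℂ} (hA : A.IsHermitian) (hB : B.IsHermitian) :
    traceCosh B - traceCosh A - (trace ((B - A) * cfc Real.sinh A)).re ≤
      (trace ((B - A) ^ 2 * cfc Real.cosh A)).re / 2 +
        (trace ((B - A) ^ 2 * cfc Real.cosh B)).re / 2 := by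
  have hBA : (B - A) ^ 2 = (A - B) ^ 2 := by noncomm_ring
  have h1 : (trace ((B - A) ^ 2 * cfc Real.cosh B)).re = ∑ i, ∑ j, eigenOverlap hA hB i j *
      ((hB.eigenvalues j - hA.eigenvalues i) ^ 2 * Real.cosh (hB.eigenvalues j)) := by
    rw [hBA, re_trace_sub_sq_mul_cfc hB hA Real.continuous_cosh, Finset.sum_comm]
    refine Finset.sum_congr rfl fun i _ => Finset.sum_congr rfl fun j _ => ?_
    rw [eigenOverlap_comm hA hB]
    ring
  have h2 : traceCosh B = ∑ i, ∑ j, eigenOverlap hA hB i j * Real.cosh (hB.eigenvalues j) := by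
    rw [traceCosh, re_trace_cfc hB hA, Finset.sum_comm]
    simp only [eigenOverlap_comm hA hB]
  rw [h1, h2, traceCosh, re_trace_cfc hA hB, re_trace_sub_mul_cfc hA hB Real.continuous_sinh,
    re_trace_sub_sq_mul_cfc hA hB Real.continuous_cosh]
  simp only [Finset.sum_div, ← Finset.sum_sub_distrib, ← Finset.sum_add_distrib]
  refine Finset.sum_le_sum fun i _ => Finset.sum_le_sum fun j _ => ?_
  have := mul_le_mul_of_nonneg_left
    (cosh_sub_cosh_sub_le (hA.eigenvalues i) (hB.eigenvalues j)) (eigenOverlap_nonneg hA hB i j)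
  linarith

/-! ### Eigenvalue and norm bounds -/

theorem isHermitian_norm_le {A : Matrix m m ℂ} (hA : A.IsHermitian) {c : ℝ} (hc : 0 ≤ c)
    (h : ∀ i, |hA.eigenvalues i| ≤ c) : ‖A‖ ≤ c := by
  have e := cfc_eq_eigenvectorUnitary_mul hA (fun x => x)
  rw [cfc_id_of_isHermitian hA, ← Unitary.coe_star] at e
  rw [e, CStarRing.norm_mul_coe_unitary, CStarRing.norm_coe_unitary_mul, l2_opNorm_diagonal]
  refine (pi_norm_le_iff_of_nonneg hc).2 fun i => ?_
  simpa using h i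

theorem re_trace_sq_mul_cfc_le {X A : Matrix m m ℂ} (hX : X.IsHermitian) (hA : A.IsHermitian)
    {f : ℝ → ℝ} (hf : ∀ x, 0 ≤ f x) {c : ℝ} (h : ∀ i, |hX.eigenvalues i| ≤ c) :
    (trace (X ^ 2 * cfc f A)).re ≤ c ^ 2 * (trace (cfc f A)).re := by
  have h0 := re_trace_cfc_mul_cfc hX hA (fun x => x * x) f
  have h1 := re_trace_cfc_mul_cfc hX hA (fun _ => 1) f
  rw [← mul_cfc_of_isHermitian hX continuous_id', cfc_id_of_isHermitian hX] at h0
  rw [cfc_one_of_isHermitian hX, one_mul] at h1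
  rw [sq X, h0, h1]
  simp only [Finset.mul_sum]
  refine Finset.sum_le_sum fun i _ => Finset.sum_le_sum fun j _ => ?_
  have h2 : hX.eigenvalues i * hX.eigenvalues i ≤ c ^ 2 := by
    rw [← sq]
    exact sq_le_sq' (abs_le.1 (h i)).1 (abs_le.1 (h i)).2
  have h3 := mul_nonneg (eigenOverlap_nonneg hX hA i j) (hf (hA.eigenvalues j))
  nlinarith [mul_le_mul_of_nonneg_right h2 h3]

theorem abs_eigenvalues_le_one {X : Matrix m m ℂ} (hX : X.IsHermitian)
    (h1 : (1 - X).PosSemidef) (h2 : (1 + X).PosSemidef) (i : m) : |hX.eigenvalues i| ≤ 1 := by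
  have hv : star (hX.eigenvectorBasis i).ofLp ⬝ᵥ (hX.eigenvectorBasis i).ofLp = 1 := by
    have h := hX.eigenvectorBasis.orthonormal.1 i
    have h' := EuclideanSpace.inner_eq_star_dotProduct (𝕜 := ℂ) (hX.eigenvectorBasis i)
      (hX.eigenvectorBasis i)
    rw [inner_self_eq_norm_sq_to_K, h] at h'
    rw [dotProduct_comm, ← h']
    simp
  have g1 := h1.dotProduct_mulVec_nonneg (hX.eigenvectorBasis i).ofLp
  have g2 := h2.dotProduct_mulVec_nonneg (hX.eigenvectorBasis i).ofLp
  rw [sub_mulVec, one_mulVec, hX.mulVec_eigenvectorBasis, dotProduct_sub, dotProduct_smul, hv] at g1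
  rw [add_mulVec, one_mulVec, hX.mulVec_eigenvectorBasis, dotProduct_add, dotProduct_smul, hv] at g2
  have g1' := (Complex.le_def.1 g1).1
  have g2' := (Complex.le_def.1 g2).1
  simp at g1' g2'
  exact abs_le.2 ⟨by linarith, g1'⟩

/-! ### Greedy selection -/

/-- A linear functional takes a value at some point of `S` not above its value at a given point
of the convex hull of `S`. -/
theorem exists_mem_apply_le_of_mem_convexHull {V : Type*} [AddCommGroup V] [Module ℝ V]
    {S : Set V} {x : V} (hx : x ∈ convexHull ℝ S) (L : V →ₗ[ℝ] ℝ) : ∃ y ∈ S, L y ≤ L x := by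
  by_contra! h
  have h' : convexHull ℝ S ⊆ {y | L x < L y} :=
    convexHull_min h (convex_halfSpace_gt L.isLinear _)
  exact lt_irrefl (L x) (h' hx)

/-- The second-order bound also involves the new potential, with coefficient `t²/2`; absorbing it on
the left produces the denominator, positive because `t² < 2`. -/
theorem exists_traceCosh_add_le {S : Set (Matrix m m ℂ)} {E M : Matrix m m ℂ}
    (hE : E ∈ convexHull ℝ S) (hM : M.IsHermitian) {t : ℝ} (ht : t ^ 2 < 2)
    (hS : ∀ F ∈ S, ∃ h : (F - E).IsHermitian, ∀ i, |h.eigenvalues i| ≤ 1) (ht0 : 0 ≤ t) :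
    ∃ F ∈ S, traceCosh (M + t • (F - E)) ≤ (1 + t ^ 2 / 2) / (1 - t ^ 2 / 2) * traceCosh M := by
  let L : Matrix m m ℂ →ₗ[ℝ] ℝ :=
    { toFun := fun F => (trace (F * cfc Real.sinh M)).re
      map_add' := fun F F' => by simp [add_mul]
      map_smul' := fun c F => by simp }
  obtain ⟨F, hF, hL⟩ := exists_mem_apply_le_of_mem_convexHull hE L
  refine ⟨F, hF, ?_⟩
  obtain ⟨hX, hX1⟩ := hS F hF
  have hB : (M + t • (F - E)).IsHermitian := hM.add (hX.smul (IsSelfAdjoint.all t))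
  have key := traceCosh_sub_le hM hB
  rw [add_sub_cancel_left, smul_mul_assoc, smul_pow, smul_mul_assoc, smul_mul_assoc, trace_smul,
    trace_smul, trace_smul, Complex.smul_re, Complex.smul_re, Complex.smul_re] at key
  have h1 := re_trace_sq_mul_cfc_le hX hM (fun x => (Real.cosh_pos x).le) hX1
  have h2 := re_trace_sq_mul_cfc_le hX hB (fun x => (Real.cosh_pos x).le) hX1
  have h3 : (trace ((F - E) * cfc Real.sinh M)).re ≤ 0 := by
    have : L (F - E) ≤ 0 := by rw [map_sub]; linarith
    exact this
  change _ ≤ 1 ^ 2 * traceCosh M at h1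
  change _ ≤ 1 ^ 2 * traceCosh _ at h2
  simp only [smul_eq_mul] at key
  have h4 := mul_le_mul_of_nonneg_left h1 (sq_nonneg t)
  have h5 := mul_le_mul_of_nonneg_left h2 (sq_nonneg t)
  have h6 := mul_nonneg ht0 (neg_nonneg.2 h3)
  rw [div_mul_eq_mul_div, le_div_iff₀ (by linarith)]
  linarith

theorem exists_traceCosh_sum_le {S : Set (Matrix m m ℂ)} {E : Matrix m m ℂ}
    (hE : E ∈ convexHull ℝ S) {t : ℝ} (ht0 : 0 ≤ t) (ht : t ^ 2 < 2)
    (hS : ∀ F ∈ S, ∃ h : (F - E).IsHermitian, ∀ i, |h.eigenvalues i| ≤ 1) (k : ℕ) :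
    ∃ F : Fin k → Matrix m m ℂ, (∀ i, F i ∈ S) ∧ (∑ i, (F i - E)).IsHermitian ∧
      traceCosh (t • ∑ i, (F i - E)) ≤
        ((1 + t ^ 2 / 2) / (1 - t ^ 2 / 2)) ^ k * Fintype.card m := by
  induction k with
  | zero =>
    refine ⟨Fin.elim0, fun i => i.elim0, by simp, ?_⟩
    simp [traceCosh, cfc_apply_zero, Algebra.algebraMap_eq_smul_one]
  | succ k ih =>
    obtain ⟨F, hF, hH, hle⟩ := ih
    obtain ⟨F', hF', hle'⟩ :=
      exists_traceCosh_add_le hE (hH.smul (IsSelfAdjoint.all t)) ht hS ht0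
    refine ⟨Fin.snoc F F', fun i => ?_, ?_, ?_⟩
    · refine Fin.lastCases ?_ (fun j => ?_) i
      · simpa using hF'
      · simpa using hF j
    · rw [Fin.sum_univ_castSucc]
      simpa using hH.add (hS F' hF').1
    · rw [Fin.sum_univ_castSucc, smul_add]
      simp only [Fin.snoc_castSucc, Fin.snoc_last]
      refine hle'.trans ?_
      rw [pow_succ' _ k, mul_assoc]
      exact mul_le_mul_of_nonneg_left hle (div_nonneg (by positivity) (by linarith))

theorem cosh_eigenvalues_le_traceCosh {A : Matrix m m ℂ} (hA : A.IsHermitian) (i : m) :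
    Real.cosh (hA.eigenvalues i) ≤ traceCosh A := by
  have h : traceCosh A = ∑ i, Real.cosh (hA.eigenvalues i) := by
    rw [traceCosh, cfc_eq_eigenvectorUnitary_mul hA, trace_mul_comm, ← mul_assoc,
      Unitary.coe_star_mul_self, one_mul, trace_diagonal, Complex.re_sum]
    simp only [Complex.ofReal_re]
  rw [h]
  exact Finset.single_le_sum (f := fun i => Real.cosh (hA.eigenvalues i))
    (fun j _ => (Real.cosh_pos _).le) (Finset.mem_univ i)

theorem abs_le_log_two_mul_of_cosh_le {x c : ℝ} (h : Real.cosh x ≤ c) :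
    |x| ≤ Real.log (2 * c) := by
  rw [Real.le_log_iff_exp_le (by linarith [Real.cosh_pos x])]
  rw [← Real.cosh_abs, Real.cosh_eq] at h
  linarith [Real.exp_pos (-|x|)]

/-- Approximate Carathéodory theorem in operator norm for sets of effects. -/
theorem exists_norm_sub_average_le [Nonempty m] {S : Set (Matrix m m ℂ)} {E : Matrix m m ℂ}
    (hS0 : ∀ F ∈ S, F.PosSemidef) (hS1 : ∀ F ∈ S, (1 - F).PosSemidef)
    (hE : E ∈ convexHull ℝ S) {ε : ℝ} (hε : 0 < ε) {k : ℕ}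
    (hk : 5 * (Real.log (Fintype.card m) + 1) ≤ k * ε ^ 2) :
    ∃ F : Fin k → Matrix m m ℂ, (∀ i, F i ∈ S) ∧
      ‖E - (1 / (k : ℝ)) • ∑ i, F i‖ ≤ ε := by
  have hD : (1 : ℝ) ≤ Fintype.card m := by exact_mod_cast Fintype.card_pos
  have hlog := Real.log_nonneg hD
  have hk0 : (0 : ℝ) < k := by
    by_contra! h
    nlinarith [mul_nonneg (neg_nonneg.2 h) (sq_nonneg ε)]
  have hE' : E.PosSemidef ∧ (1 - E).PosSemidef := by
    have hconv : Convex ℝ {F : Matrix m m ℂ | F.PosSemidef ∧ (1 - F).PosSemidef} := by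
      intro A hA B hB a b ha hb hab
      refine ⟨(hA.1.smul ha).add (hB.1.smul hb), ?_⟩
      have e : 1 - (a • A + b • B) = a • (1 - A) + b • (1 - B) := by
        have : (1 : Matrix m m ℂ) = a • 1 + b • 1 := by rw [← add_smul, hab, one_smul]
        rw [smul_sub, smul_sub]
        nth_rw 1 [this]
        abel
      rw [e]
      exact (hA.2.smul ha).add (hB.2.smul hb)
    have hsub : S ⊆ {F : Matrix m m ℂ | F.PosSemidef ∧ (1 - F).PosSemidef} :=
      fun F hF => ⟨hS0 F hF, hS1 F hF⟩
    exact convexHull_min hsub hconv hE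
  have hS : ∀ F ∈ S, ∃ h : (F - E).IsHermitian, ∀ i, |h.eigenvalues i| ≤ 1 := by
    intro F hF
    refine ⟨(hS0 F hF).1.sub hE'.1.1, abs_eigenvalues_le_one _ ?_ ?_⟩
    · have := (hS1 F hF).add hE'.1
      rwa [show 1 - F + E = 1 - (F - E) by abel] at this
    · have := (hS0 F hF).add hE'.2
      rwa [show F + (1 - E) = 1 + (F - E) by abel] at this
  have havg : ∀ F : Fin k → Matrix m m ℂ,
      ‖E - (1 / (k : ℝ)) • ∑ i, F i‖ = 1 / k * ‖∑ i, (F i - E)‖ := by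
    intro F
    have e : E - (1 / (k : ℝ)) • ∑ i, F i = -((1 / (k : ℝ)) • ∑ i, (F i - E)) := by
      rw [Finset.sum_sub_distrib, Finset.sum_const, Finset.card_univ, Fintype.card_fin, smul_sub,
        ← Nat.cast_smul_eq_nsmul ℝ, smul_smul, one_div_mul_cancel hk0.ne', one_smul]
      abel
    rw [e, norm_neg, norm_smul, Real.norm_of_nonneg (by positivity)]
  rcases le_or_gt 1 ε with h1 | h1
  -- For `ε ≥ 1` any constant choice works, since `‖F - E‖ ≤ 1`.
  · obtain ⟨F, hF⟩ := convexHull_nonempty_iff.1 (Set.nonempty_of_mem hE)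
    refine ⟨fun _ => F, fun _ => hF, ?_⟩
    obtain ⟨hX, hX1⟩ := hS F hF
    rw [havg, Finset.sum_const, Finset.card_univ, Fintype.card_fin, ← Nat.cast_smul_eq_nsmul ℝ,
      norm_smul, Real.norm_of_nonneg hk0.le, ← mul_assoc, one_div_mul_cancel hk0.ne', one_mul]
    exact (isHermitian_norm_le hX zero_le_one hX1).trans h1
  · have ht2 : (ε / 2) ^ 2 ≤ 1 / 4 := by nlinarith
    obtain ⟨F, hF, hH, hle⟩ :=
      exists_traceCosh_sum_le hE (t := ε / 2) (by positivity) (by linarith) hS k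
    refine ⟨F, hF, ?_⟩
    -- The ratio is `1 + t²/(1 - t²/2)` with `t² = ε²/4 ≤ 1/4`, hence at most `1 + (2/7) ε²`; `3/10`
    -- leaves some slack.
    have hr : (1 + (ε / 2) ^ 2 / 2) / (1 - (ε / 2) ^ 2 / 2) ≤ Real.exp (3 / 10 * ε ^ 2) := by
      refine le_trans ?_ (Real.add_one_le_exp _)
      rw [div_le_iff₀ (by linarith)]
      nlinarith [mul_nonneg (sq_nonneg ε) (sub_nonneg.2 ht2)]
    have hr0 : 0 ≤ (1 + (ε / 2) ^ 2 / 2) / (1 - (ε / 2) ^ 2 / 2) :=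
      div_nonneg (by positivity) (by linarith)
    have hle2 : traceCosh ((ε / 2) • ∑ i, (F i - E)) ≤
        Real.exp (3 / 10 * ε ^ 2) ^ k * Fintype.card m := by
      refine hle.trans ?_
      gcongr
    have hM : ((ε / 2) • ∑ i, (F i - E)).IsHermitian := hH.smul (IsSelfAdjoint.all _)
    have hnorm : ‖(ε / 2) • ∑ i, (F i - E)‖ ≤ ε / 2 * (k * ε) := by
      refine isHermitian_norm_le hM (by positivity) fun i => ?_
      refine (abs_le_log_two_mul_of_cosh_le
        ((cosh_eigenvalues_le_traceCosh hM i).trans hle2)).trans ?_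
      rw [Real.log_mul (by norm_num) (by positivity), Real.log_mul (by positivity) (by positivity),
        Real.log_pow, Real.log_exp]
      -- It remains to see `log 2 + (3/10) k ε² + log D ≤ (1/2) k ε²`, that is `5 (log D + log 2) ≤
      -- k ε²`. This is the source of the constant 5, and the `+ 1` in `hk` covers `log 2`.
      have := Real.log_two_lt_d9
      nlinarith
    rw [norm_smul, Real.norm_of_nonneg (by positivity)] at hnorm
    have := le_of_mul_le_mul_left hnorm (by positivity)
    rw [havg, one_div, inv_mul_le_iff₀ hk0]
    exact this

end ApproximateCaratheodory

theorem mainTheorem8 (d : ℕ) (hd : 0 < d) (G : Set EffMeas.Gate) (p : Polynomial ℝ)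
    (Eff : ∀ n : ℕ, Set (EffMeas.Op d n)) (hEff : EffMeas.IsPolyGenerated d G p Eff)
    (n : ℕ) (E : EffMeas.Op d n) (hE : E ∈ convexHull ℝ (Eff n))
    (ε : ℝ) (hε : 0 < ε) (k : ℕ)
    (hk : 5 * ((n : ℝ) * Real.log (d : ℝ) + 1) / ε ^ 2 ≤ (k : ℝ)) :
    ∃ F : Fin k → EffMeas.Op d n, (∀ i, F i ∈ Eff n) ∧
      EffMeas.opNorm (E - (1 / (k : ℝ)) • ∑ i, F i) ≤ ε := by
  have : Nonempty (Fin d) := ⟨⟨0, hd⟩⟩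
  have hcard : Real.log (Fintype.card (Fin n → Fin d)) = n * Real.log d := by
    simp
  refine exists_norm_sub_average_le (fun F hF => (hEff.isEffect n F hF).1)
    (fun F hF => (hEff.isEffect n F hF).2) hE hε ?_
  rw [hcard]
  exact (div_le_iff₀ (by positivity)).1 hk
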